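/- Let $D\subset\mathbb R^3$ be an open set containing the origin, and let $u\in C^1(D\setminus\{0\},\mathbb R^3)$ be divergence-free on $D\setminus\{0\}$. Write $B_\rho$ for the open ball of radius $\rho$ centered at $0$, $\hat n(x)=x/|x|$, and $\sigma$ for the surface measure on spheres. For $0<r<\alpha$ let $A_r^\alpha$ be the set of all $\eta\in\partial B_\alpha$ for which there are $s>0$ and a curve $\gamma:[0,s]\to D\setminus\{0\}$ with $\gamma(0)=\eta$ and $\gamma'(t)=u(\gamma(t))$ for $0\le t\le s$ (a streamline starting at $\eta$), such that $\gamma(s)\in B_r$ and $\gamma(t)\in B_\alpha$ for all $0<t<s$. Suppose that for some $\alpha>0$ and some constant $C>0$ (independent of $r$), for all sufficiently small $r>0$ the integral below converges absolutely and $$\Big|\int_{A_r^\alpha}u\cdot\hat n\,d\sigma\Big|\ \ge\ C\,r^{1/2}.$$ (Absolute convergence is automatic if $\partial B_\alpha\subset D$.) Then $u\notin L^2(D)$; in particular, if $D=\mathbb R^3$, then $u\notin L^2(\mathbb R^3)$, and in general no extension of $u$ to $\mathbb R^3$ belongs to $L^2(\mathbb R^3)$. -/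

import Mathlib

open Set Filter Topology MeasureTheory

noncomputable section

/-- Euclidean three-space. -/
abbrev E3 : Type := EuclideanSpace ℝ (Fin 3)

/-- The divergence `∑ i, ∂ᵢ uᵢ` of a vector field at the point `x`. -/
def divergence (u : E3 → E3) (x : E3) : ℝ :=
  ∑ i : Fin 3, (fderiv ℝ u x (EuclideanSpace.single i 1)) i

/-- The unit vector field `x / |x|`. -/
def unitNormal (x : E3) : E3 := ‖x‖⁻¹ • x

/-- The surface measure on the sphere of radius `ρ > 0` about the origin, as a measure on
three-space: the surface measure of the unit sphere (of total mass `4 π`), transported by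
`ω ↦ ρ ω` and multiplied by `ρ ^ 2`. -/
def sphereMeasure (ρ : ℝ) : Measure E3 :=
  ENNReal.ofReal (ρ ^ 2) •
    ((volume : Measure E3).toSphere).map
      (fun ω : Metric.sphere (0 : E3) 1 => ρ • (ω : E3))

/-- `γ` restricted to the time interval `[0, s]` is a streamline, with starting point `η`, of the
vector field `u` whose domain of definition is `D` without the origin. -/
structure IsStreamline (D : Set E3) (u : E3 → E3) (η : E3) (s : ℝ) (γ : ℝ → E3) : Prop where
  start : γ 0 = η
  mem_domain : ∀ t ∈ Icc 0 s, γ t ∈ D \ {0}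
  hasDeriv : ∀ t ∈ Icc 0 s, HasDerivWithinAt γ (u (γ t)) (Icc 0 s) t

/-- The set of points `η` of the sphere of radius `α` whose streamline is inside the open ball of
radius `r` at some time `s > 0` and inside the open ball of radius `α` at all times in `(0, s)`.
(The streamline only has to exist up to the time `s`.) -/
def enteringSet (D : Set E3) (u : E3 → E3) (α r : ℝ) : Set E3 :=
  {η | η ∈ Metric.sphere (0 : E3) α ∧
    ∃ s : ℝ, 0 < s ∧ ∃ γ : ℝ → E3, IsStreamline D u η s γ ∧
      γ s ∈ Metric.ball (0 : E3) r ∧ ∀ t ∈ Ioo 0 s, γ t ∈ Metric.ball (0 : E3) α}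

/-- The flux `∫_{A} u · n dσ` of `u` through a subset `A` of the sphere of radius `α`. -/
def sphereFlux (u : E3 → E3) (α : ℝ) (A : Set E3) : ℝ :=
  ∫ η in A, inner ℝ (u η) (unitNormal η) ∂(sphereMeasure α)

end

/-! Each streamline from the entering set crosses the shell between radii `2 * r` and `r`, so its
length inside the shell is at least `r`. In coordinates (starting point on the sphere, elapsed
time), volume is `|u · n| dσ dt`: incompressibility keeps the flux density constant along
streamlines. Distinct streamlines do not overlap, so integrating `|u|` over the tube they sweep
gives `r * |flux| ≤ ∫_shell |u|` (`ofReal_mul_enorm_sphereFlux_le`). By Cauchy–Schwarz the square of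
the right side is at most a constant times `r ^ 3 * ∫_shell |u|²`. With flux at least `C * r ^ (1 /
2)` the powers of `r` cancel exactly, leaving a positive lower bound for the energy in shells
shrinking to the origin. For `u ∈ L²` that energy tends to zero, a contradiction.

Since `u` is only `C¹` off the origin, its streamlines need not be global. `D \ {0}` is exhausted by
open sets with compact hulls; on each, `u` is replaced by a compactly supported `C¹` field `v`,
which has a global flow. The change of variables rests on `IsFlow.exists_hasFDerivAt_radialMap`
(Jacobian) and `IsFlow.injOn_radialMap` (injectivity); `IsFlow.mul_setLIntegral_enteringSet_le`
gives the bound for one cutoff. -/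

/-- `Φ` is a globally defined flow of the autonomous vector field `v`. -/
structure IsFlow {E : Type*} [NormedAddCommGroup E] [NormedSpace ℝ E]
    (v : E → E) (Φ : ℝ → E → E) : Prop where
  zero : ∀ x, Φ 0 x = x
  deriv : ∀ x t, HasDerivAt (fun s => Φ s x) (v (Φ t x)) t

/-! ### Global flows of bounded Lipschitz fields: existence, uniqueness, continuity. -/

section Flow

variable {E : Type*} [NormedAddCommGroup E] [NormedSpace ℝ E] {v : E → E} {Φ : ℝ → E → E}
  {K : NNReal}

theorem exists_integralCurve_Icc [CompleteSpace E] (hv : LipschitzWith K v) {M : NNReal}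
    (hM : ∀ x, ‖v x‖ ≤ M) (x : E) {T : ℝ} (hT : 0 ≤ T) :
    ∃ γ : ℝ → E, γ 0 = x ∧ ∀ t ∈ Icc (-T) T, HasDerivWithinAt γ (v (γ t)) (Icc (-T) T) t := by
  -- Radius `M * T` suffices: speed at most `M` cannot leave that ball within time `T`.
  have h : IsPicardLindelof (fun _ : ℝ => v) (⟨0, by simp [hT], hT⟩ : Icc (-T) T) x
      (M * ⟨T, hT⟩) 0 M K :=
    { lipschitzOnWith := fun _ _ => hv.lipschitzOnWith
      continuousOn := fun _ _ => continuousOn_const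
      norm_le := fun _ _ y _ => hM y
      mul_max_le := by
        simp only [sub_zero, zero_sub, neg_neg, max_self, NNReal.coe_zero]
        exact le_of_eq rfl }
  exact h.exists_eq_forall_mem_Icc_hasDerivWithinAt₀

theorem exists_isFlow [CompleteSpace E] (hv : LipschitzWith K v) {M : NNReal}
    (hM : ∀ x, ‖v x‖ ≤ M) : ∃ Φ : ℝ → E → E, IsFlow v Φ := by
  choose γ hγ0 hγ using fun (x : E) (n : ℕ) =>
    exists_integralCurve_Icc hv hM x (T := (n : ℝ) + 1) (by positivity)
  have hd : ∀ x (n : ℕ) t, t ∈ Ioo (-((n : ℝ) + 1)) (n + 1) → HasDerivAt (γ x n) (v (γ x n t)) t :=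
    fun x n t ht => (hγ x n t (Ioo_subset_Icc_self ht)).hasDerivAt (Icc_mem_nhds ht.1 ht.2)
  have hmono : ∀ x (n m : ℕ), n ≤ m → ∀ t ∈ Ioo (-((n : ℝ) + 1)) (n + 1), γ x n t = γ x m t := by
    intro x n m hnm
    have hnm' : (n : ℝ) ≤ m := by exact_mod_cast hnm
    refine ODE_solution_unique_of_mem_Ioo (v := fun _ => v) (s := fun _ => univ) (K := K) (t₀ := 0)
      (fun _ _ => hv.lipschitzOnWith) ⟨by linarith [n.cast_nonneg (α := ℝ)], by positivity⟩
      (fun t ht => ⟨hd x n t ht, trivial⟩)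
      (fun t ht => ⟨hd x m t ⟨by linarith [ht.1], by linarith [ht.2]⟩, trivial⟩) ?_
    rw [hγ0, hγ0]
  have hagree : ∀ x (n m : ℕ) t, t ∈ Ioo (-((n : ℝ) + 1)) (n + 1) →
      t ∈ Ioo (-((m : ℝ) + 1)) (m + 1) → γ x n t = γ x m t := by
    intro x n m t hn hm
    rcases le_total n m with h | h
    · exact hmono x n m h t hn
    · exact (hmono x m n h t hm).symm
  have hmem : ∀ t : ℝ, t ∈ Ioo (-((⌈|t|⌉₊ : ℝ) + 1)) (⌈|t|⌉₊ + 1) := by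
    intro t
    have := abs_le.1 (Nat.le_ceil |t|)
    exact ⟨by linarith [this.1], by linarith [this.2]⟩
  -- The extra `+ 1` in the time intervals makes `t` an interior point of interval `⌈|t|⌉₊`, so the
  -- derivative there is two-sided.
  refine ⟨fun t x => γ x ⌈|t|⌉₊ t, fun x => hγ0 _ _, fun x t => ?_⟩
  refine (hd x ⌈|t|⌉₊ t (hmem t)).congr_of_eventuallyEq ?_
  filter_upwards [Ioo_mem_nhds (hmem t).1 (hmem t).2] with s hs
  exact hagree x _ _ s (hmem s) hs

namespace IsFlow

/-- Uniqueness identifies streamlines of the original field with flow lines of the cutoff as long as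
they stay where the two fields agree. -/
theorem eq_of_hasDerivWithinAt (hΦ : IsFlow v Φ) (hv : LipschitzWith K v) {γ : ℝ → E} {s : ℝ}
    (h : ∀ t ∈ Icc 0 s, HasDerivWithinAt γ (v (γ t)) (Icc 0 s) t) :
    ∀ t ∈ Icc 0 s, γ t = Φ t (γ 0) := by
  refine ODE_solution_unique (v := fun _ => v) (K := K) (fun _ => hv)
    (fun t ht => (h t ht).continuousWithinAt) (fun t ht => ?_)
    (fun t _ => (hΦ.deriv _ t).continuousAt.continuousWithinAt)
    (fun t _ => (hΦ.deriv _ t).hasDerivWithinAt) (hΦ.zero _).symm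
  exact (h t (Ico_subset_Icc_self ht)).mono_of_mem_nhdsWithin
    (mem_of_superset (Icc_mem_nhdsGE ht.2) (Icc_subset_Icc_left ht.1))

theorem add (hΦ : IsFlow v Φ) (hv : LipschitzWith K v) (s t : ℝ) (x : E) :
    Φ (s + t) x = Φ s (Φ t x) := by
  have := ODE_solution_unique_univ (v := fun _ => v) (s := fun _ => univ) (K := K) (t₀ := 0)
    (f := fun s => Φ (s + t) x) (g := fun s => Φ s (Φ t x)) (fun _ => hv.lipschitzOnWith)
    (fun r => ⟨HasDerivAt.comp_add_const r t (hΦ.deriv x (r + t)), trivial⟩)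
    (fun r => ⟨hΦ.deriv _ r, trivial⟩) (by simp [hΦ.zero])
  exact congrFun this s

theorem dist_le (hΦ : IsFlow v Φ) (hv : LipschitzWith K v) {t : ℝ} (ht : 0 ≤ t) (x y : E) :
    dist (Φ t x) (Φ t y) ≤ dist x y * Real.exp (K * t) := by
  have := dist_le_of_trajectories_ODE (v := fun _ => v) (K := K) (a := 0) (b := t)
    (f := fun s => Φ s x) (g := fun s => Φ s y) (δ := dist x y) (fun _ => hv)
    (fun r _ => (hΦ.deriv _ r).continuousAt.continuousWithinAt)
    (fun r _ => (hΦ.deriv _ r).hasDerivWithinAt)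
    (fun r _ => (hΦ.deriv _ r).continuousAt.continuousWithinAt)
    (fun r _ => (hΦ.deriv _ r).hasDerivWithinAt) (by simp [hΦ.zero]) t ⟨ht, le_rfl⟩
  simpa using this

theorem neg (hΦ : IsFlow v Φ) : IsFlow (fun x => - v x) (fun t => Φ (-t)) where
  zero x := by simp [hΦ.zero]
  deriv x t := by
    simpa [Function.comp_def] using (hΦ.deriv x (-t)).scomp t (hasDerivAt_neg t)

theorem dist_le_abs (hΦ : IsFlow v Φ) (hv : LipschitzWith K v) (t : ℝ) (x y : E) :
    dist (Φ t x) (Φ t y) ≤ dist x y * Real.exp (K * |t|) := by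
  rcases le_total 0 t with h | h
  · simpa [abs_of_nonneg h] using hΦ.dist_le hv h x y
  · have := hΦ.neg.dist_le hv.neg (neg_nonneg.2 h) x y
    simpa [abs_of_nonpos h] using this

theorem continuous_time (hΦ : IsFlow v Φ) (x : E) : Continuous fun t => Φ t x :=
  continuous_iff_continuousAt.2 fun t => (hΦ.deriv x t).continuousAt

/-- The flow is Lipschitz in space with a constant locally bounded in time, and continuous in time
for fixed `x`; the triangle inequality combines the two. -/
theorem continuous_uncurry (hΦ : IsFlow v Φ) (hv : LipschitzWith K v) :
    Continuous fun p : ℝ × E => Φ p.1 p.2 := by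
  rw [continuous_iff_continuousAt]
  rintro ⟨t, x⟩
  have h1 : Tendsto (fun p : ℝ × E => dist p.2 x * Real.exp (K * |p.1|) + dist (Φ p.1 x) (Φ t x))
      (𝓝 (t, x)) (𝓝 0) := by
    have : Continuous fun p : ℝ × E =>
        dist p.2 x * Real.exp (K * |p.1|) + dist (Φ p.1 x) (Φ t x) := by
      have := (hΦ.continuous_time x).comp (continuous_fst (X := ℝ) (Y := E))
      exact (by fun_prop : Continuous fun p : ℝ × E => dist p.2 x * Real.exp (K * |p.1|)).add
        (this.dist continuous_const)
    simpa using this.tendsto (t, x)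
  refine tendsto_iff_dist_tendsto_zero.2 (squeeze_zero (fun _ => dist_nonneg) (fun p => ?_) h1)
  exact (dist_triangle _ (Φ p.1 x) _).trans (add_le_add_left (hΦ.dist_le_abs hv _ _ _) _)

/-- The flow is differentiable in time and space jointly at time zero. -/
theorem hasFDerivAt_zero (hΦ : IsFlow v Φ) (hv : LipschitzWith K v) (z : E) :
    HasFDerivAt (fun p : ℝ × E => Φ p.1 p.2)
      ((ContinuousLinearMap.fst ℝ ℝ E).smulRight (v z) + ContinuousLinearMap.snd ℝ ℝ E)
      (0, z) := by
  rw [hasFDerivAt_iff_isLittleO, Asymptotics.isLittleO_iff]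
  intro ε hε
  have hc : ContinuousAt (fun p : ℝ × E => ‖v (Φ p.1 p.2) - v z‖) (0, z) := by
    have := hv.continuous.comp (hΦ.continuous_uncurry hv)
    exact ((this.sub continuous_const).norm).continuousAt
  have hnear : ∀ᶠ p in 𝓝 ((0 : ℝ), z), ‖v (Φ p.1 p.2) - v z‖ < ε := by
    refine hc.eventually_lt continuousAt_const ?_
    simpa [hΦ.zero] using hε
  obtain ⟨δ, hδ, hball⟩ := Metric.eventually_nhds_iff_ball.1 hnear
  filter_upwards [Metric.ball_mem_nhds ((0 : ℝ), z) hδ] with p hp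
  rw [← ball_prod_same, mem_prod] at hp
  -- Subtracting the linear motion `s • v z` leaves a curve of speed at most `ε` near `(0, z)`; the
  -- mean value inequality then gives the error bound.
  have hder : ∀ s ∈ Metric.ball (0 : ℝ) δ,
      HasDerivWithinAt (fun s => Φ s p.2 - s • v z) (v (Φ s p.2) - v z) (Metric.ball 0 δ) s := by
    intro s _
    have := (hΦ.deriv p.2 s).fun_sub ((hasDerivAt_id s).smul_const (v z))
    simpa using this.hasDerivWithinAt
  have hb : ∀ s ∈ Metric.ball (0 : ℝ) δ, ‖v (Φ s p.2) - v z‖ ≤ ε := by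
    intro s hs
    refine (hball (s, p.2) ?_).le
    rw [← ball_prod_same]
    exact ⟨hs, hp.2⟩
  have := (convex_ball (0 : ℝ) δ).norm_image_sub_le_of_norm_hasDerivWithin_le hder hb
    (Metric.mem_ball_self hδ) hp.1
  simp only [hΦ.zero, zero_smul, sub_zero] at this
  have hn : ‖p.1‖ ≤ ‖p - ((0 : ℝ), z)‖ := by simpa using norm_fst_le (p - ((0 : ℝ), z))
  calc _ = ‖Φ p.1 p.2 - p.1 • v z - p.2‖ := by
        congr 1
        simp [hΦ.zero]
        abel
    _ ≤ ε * ‖p.1‖ := this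
    _ ≤ _ := by gcongr

/-- The derivative of the flow map transports the vector field. -/
theorem fderiv_apply_field (hΦ : IsFlow v Φ) (hv : LipschitzWith K v) {T : ℝ} {x : E}
    {V : E →L[ℝ] E} (hV : HasFDerivAt (Φ T) V x) : V (v x) = v (Φ T x) := by
  have h1 : HasDerivAt (fun h => Φ T (Φ h x)) (V (v x)) 0 := by
    have h0 := hΦ.deriv x 0
    rw [hΦ.zero] at h0
    refine HasFDerivAt.comp_hasDerivAt (0 : ℝ) ?_ h0
    simpa [hΦ.zero] using hV
  have h2 : HasDerivAt (fun h => Φ (T + h) x) (v (Φ T x)) 0 := by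
    have := HasDerivAt.comp_const_add T 0 (f := fun s => Φ s x) (by simpa using hΦ.deriv x T)
    simpa using this
  refine h1.unique (h2.congr_of_eventuallyEq (Eventually.of_forall fun h => ?_))
  exact (hΦ.add hv T h x).symm

end IsFlow

/-! ### Spatial differentiability of the flow through the linearized equation. -/

/-- Short time solvability of the linear equation `V' = A V`, `V 0 = 1`. -/
theorem exists_linear_ode_solution [CompleteSpace E] {A : ℝ → E →L[ℝ] E} (hA : Continuous A)
    {L : NNReal} (hL : ∀ t, ‖A t‖ ≤ L) {T : ℝ} (hT : 0 ≤ T) (hLT : 2 * L * T ≤ 1) :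
    ∃ V : ℝ → E →L[ℝ] E, V 0 = ContinuousLinearMap.id ℝ E ∧
      ∀ t ∈ Icc 0 T, HasDerivWithinAt V ((A t).comp (V t)) (Icc 0 T) t := by
  have h : IsPicardLindelof (fun (t : ℝ) (W : E →L[ℝ] E) => (A t).comp W)
      (⟨0, by simp [hT]⟩ : Icc 0 T) (ContinuousLinearMap.id ℝ E) 1 0 (2 * L) L := by
    constructor
    · intro t _
      refine (LipschitzWith.of_dist_le_mul fun W W' => ?_).lipschitzOnWith
      rw [dist_eq_norm, dist_eq_norm, ← ContinuousLinearMap.comp_sub]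
      exact (ContinuousLinearMap.opNorm_comp_le _ _).trans (by gcongr; exact hL t)
    · intro W _
      exact (hA.clm_comp continuous_const).continuousOn
    · intro t _ W hW
      -- In the unit ball about the identity the right-hand side is at most `2 * L`, whence the
      -- smallness condition `2 * L * T ≤ 1`.
      have hW' : ‖W‖ ≤ 2 := by
        have h1 : ‖W - ContinuousLinearMap.id ℝ E‖ ≤ 1 := by
          simpa [dist_eq_norm] using hW
        have h2 := ContinuousLinearMap.norm_id_le (𝕜 := ℝ) (E := E)
        have h3 := norm_le_norm_add_norm_sub' W (ContinuousLinearMap.id ℝ E)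
        linarith
      calc _ ≤ ‖A t‖ * ‖W‖ := ContinuousLinearMap.opNorm_comp_le _ _
        _ ≤ L * 2 := by gcongr; exact hL t
        _ = _ := by push_cast; ring
    · simpa [hT] using hLT
  exact h.exists_eq_forall_mem_Icc_hasDerivWithinAt₀

/-- A compactly supported `C¹` map is uniformly differentiable. -/
theorem HasCompactSupport.uniform_differentiability (hv : ContDiff ℝ 1 v)
    (hc : HasCompactSupport v) {ε : ℝ} (hε : 0 < ε) :
    ∃ δ > 0, ∀ a b, ‖b - a‖ < δ → ‖v b - v a - fderiv ℝ v a (b - a)‖ ≤ ε * ‖b - a‖ := by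
  have huc : UniformContinuous (fderiv ℝ v) :=
    (hc.fderiv ℝ).uniformContinuous_of_continuous (hv.continuous_fderiv one_ne_zero)
  obtain ⟨δ, hδ, h⟩ := Metric.uniformContinuous_iff.1 huc ε hε
  refine ⟨δ, hδ, fun a b hab => ?_⟩
  refine (convex_ball a δ).norm_image_sub_le_of_norm_fderiv_le' (𝕜 := ℝ)
    (fun x _ => hv.differentiable one_ne_zero x) (fun x hx => ?_) (Metric.mem_ball_self hδ) ?_
  · rw [← dist_eq_norm]
    exact (h hx).le
  · rwa [Metric.mem_ball, dist_eq_norm]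

/-- The flow map is differentiable in space, with derivative the solution of the linearized
equation. -/
theorem IsFlow.hasFDerivAt_of_linear_ode (hΦ : IsFlow v Φ) (hv : ContDiff ℝ 1 v)
    (hc : HasCompactSupport v) {x : E} {T : ℝ} (hT : 0 ≤ T) {V : ℝ → E →L[ℝ] E}
    (hV0 : V 0 = ContinuousLinearMap.id ℝ E)
    (hV : ∀ t ∈ Icc 0 T,
      HasDerivWithinAt V ((fderiv ℝ v (Φ t x)).comp (V t)) (Icc 0 T) t) :
    HasFDerivAt (Φ T) (V T) x := by
  obtain ⟨K, hK⟩ := hv.lipschitzWith_of_hasCompactSupport hc one_ne_zero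
  -- Gronwall bounds with zero initial error are linear in the forcing, so `c` can be fixed before
  -- `ε` and `k`.
  set c := gronwallBound 0 K (Real.exp (K * T)) T with hc'
  have hc0 : 0 ≤ c := by
    have := gronwallBound_mono (δ := 0) (ε := Real.exp (K * T)) (K := K) le_rfl
      (Real.exp_pos _).le K.2 hT
    simpa [gronwallBound_x0] using this
  have hscale : ∀ m : ℝ, gronwallBound 0 K (m * Real.exp (K * T)) T = m * c := by
    intro m
    rw [hc']
    unfold gronwallBound
    split_ifs <;> ring
  rw [hasFDerivAt_iff_isLittleO_nhds_zero, Asymptotics.isLittleO_iff]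
  intro ε hε
  -- The `+ 1` is needed because `c` vanishes at `T = 0`.
  obtain ⟨δ, hδ, hunif⟩ := hc.uniform_differentiability hv (ε := ε / (c + 1)) (by positivity)
  have hsmall : ∀ᶠ k in 𝓝 (0 : E), ‖k‖ * Real.exp (K * T) < δ := by
    have : Continuous fun k : E => ‖k‖ * Real.exp (K * T) := by fun_prop
    exact this.continuousAt.eventually_lt continuousAt_const (by simpa using hδ)
  filter_upwards [hsmall] with k hk
  have hdiff : ∀ t ∈ Icc 0 T, ‖Φ t (x + k) - Φ t x‖ ≤ ‖k‖ * Real.exp (K * T) := by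
    intro t ht
    have := hΦ.dist_le hK ht.1 (x + k) x
    rw [dist_eq_norm, dist_eq_norm, add_sub_cancel_left] at this
    refine this.trans ?_
    gcongr
    exact ht.2
  have hder : ∀ t ∈ Icc 0 T, HasDerivWithinAt (fun t => Φ t (x + k) - Φ t x - V t k)
      (v (Φ t (x + k)) - v (Φ t x) - fderiv ℝ v (Φ t x) (V t k)) (Icc 0 T) t := by
    intro t ht
    have h1 := (hV t ht).clm_apply (hasDerivWithinAt_const t (Icc 0 T) k)
    have h2 := (((hΦ.deriv (x + k) t).fun_sub (hΦ.deriv x t)).hasDerivWithinAt (s := Icc 0 T)).fun_sub h1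
    simpa using h2
  have := norm_le_gronwallBound_of_norm_deriv_right_le (δ := 0) (K := K)
    (ε := ε / (c + 1) * ‖k‖ * Real.exp (K * T))
    (fun t ht => (hder t ht).continuousWithinAt)
    (fun t ht => (hder t (Ico_subset_Icc_self ht)).mono_of_mem_nhdsWithin
      (mem_of_superset (Icc_mem_nhdsGE ht.2) (Icc_subset_Icc_left ht.1)))
    (by simp [hΦ.zero, hV0]) (fun t ht => ?_) T ⟨hT, le_rfl⟩
  · rw [sub_zero, hscale] at this
    refine this.trans ?_
    have : ε / (c + 1) * c ≤ ε := by
      rw [div_mul_eq_mul_div, div_le_iff₀ (by positivity)]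
      nlinarith
    calc ε / (c + 1) * ‖k‖ * c = ε / (c + 1) * c * ‖k‖ := by ring
      _ ≤ ε * ‖k‖ := by gcongr
  · have hd := hdiff t (Ico_subset_Icc_self ht)
    have h1 := hunif (Φ t x) (Φ t (x + k)) (hd.trans_lt hk)
    have h2 : ‖fderiv ℝ v (Φ t x) (Φ t (x + k) - Φ t x - V t k)‖
        ≤ K * ‖Φ t (x + k) - Φ t x - V t k‖ :=
      ContinuousLinearMap.le_of_opNorm_le _ (norm_fderiv_le_of_lipschitz ℝ hK) _
    calc _ = ‖fderiv ℝ v (Φ t x) (Φ t (x + k) - Φ t x - V t k) +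
          (v (Φ t (x + k)) - v (Φ t x) - fderiv ℝ v (Φ t x) (Φ t (x + k) - Φ t x))‖ := by
          congr 1
          rw [map_sub (fderiv ℝ v (Φ t x)) (Φ t (x + k) - Φ t x)]
          abel
      _ ≤ _ := (norm_add_le _ _).trans (add_le_add h2 (h1.trans ?_))
    rw [mul_assoc]
    gcongr

end Flow


/-! ### Liouville's theorem: divergence-free flows have Jacobian one. -/

section Determinant

theorem clm_apply_coord (f : E3 →L[ℝ] E3) (x : E3) (i : Fin 3) :
    f x i = ∑ k, f (EuclideanSpace.single k 1) i * x k := by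
  have hx : x = ∑ k, x k • EuclideanSpace.single k (1 : ℝ) := by
    ext j
    simp [Pi.single_apply]
  conv_lhs => rw [hx, map_sum]
  simp [mul_comm]

theorem clm_det_eq (f : E3 →L[ℝ] E3) :
    f.det = Matrix.det (Matrix.of fun i j : Fin 3 => f (EuclideanSpace.single j 1) i) := by
  rw [ContinuousLinearMap.det,
    ← LinearMap.det_toMatrix (EuclideanSpace.basisFun (Fin 3) ℝ).toBasis]
  congr 1

/-- A rank-one perturbation of `c • id` has eigenvalue `c` twice and `c + ⟪ω, w⟫` once. -/
theorem clm_det_smul_id_add_smulRight (c : ℝ) (ω w : E3) :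
    (c • ContinuousLinearMap.id ℝ E3 + (innerSL ℝ ω).smulRight w).det
      = c ^ 3 + c ^ 2 * inner ℝ ω w := by
  rw [clm_det_eq, Matrix.det_fin_three]
  simp [PiLp.inner_apply, Fin.sum_univ_three]
  ring

theorem clm_det_comp (f g : E3 →L[ℝ] E3) : (f.comp g).det = f.det * g.det := by
  simp [ContinuousLinearMap.det, LinearMap.det_comp]

/-- A solution of the linear equation `V' = A V` with trace-free `A` has constant determinant. -/
theorem det_eq_one_of_linear_ode {A V : ℝ → E3 →L[ℝ] E3} {T : ℝ}
    (hV0 : V 0 = ContinuousLinearMap.id ℝ E3)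
    (hV : ∀ t ∈ Icc 0 T, HasDerivWithinAt V ((A t).comp (V t)) (Icc 0 T) t)
    (htr : ∀ t ∈ Icc 0 T, ∑ i : Fin 3, A t (EuclideanSpace.single i 1) i = 0) :
    ∀ t ∈ Icc 0 T, (V t).det = 1 := by
  have hentry : ∀ i j : Fin 3, ∀ t ∈ Icc 0 T,
      HasDerivWithinAt (fun t => V t (EuclideanSpace.single j 1) i)
        (∑ k, A t (EuclideanSpace.single k 1) i * V t (EuclideanSpace.single j 1) k)
        (Icc 0 T) t := by
    intro i j t ht
    have h1 := (hV t ht).clm_apply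
      (hasDerivWithinAt_const t (Icc 0 T) (EuclideanSpace.single j (1 : ℝ)))
    have h2 := (EuclideanSpace.proj (𝕜 := ℝ) i).hasFDerivAt.comp_hasDerivWithinAt t h1
    rw [← clm_apply_coord]
    simpa [Function.comp_def] using h2
  have hdet : ∀ t ∈ Icc 0 T, HasDerivWithinAt (fun t => (V t).det) 0 (Icc 0 T) t := by
    intro t ht
    have e := fun i j => hentry i j t ht
    have := (((((((e 0 0).fun_mul (e 1 1)).fun_mul (e 2 2)).fun_sub
      (((e 0 0).fun_mul (e 1 2)).fun_mul (e 2 1))).fun_sub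
      (((e 0 1).fun_mul (e 1 0)).fun_mul (e 2 2))).fun_add
      (((e 0 1).fun_mul (e 1 2)).fun_mul (e 2 0))).fun_add
      (((e 0 2).fun_mul (e 1 0)).fun_mul (e 2 1))).fun_sub
      (((e 0 2).fun_mul (e 1 1)).fun_mul (e 2 0))
    have hexp : ∀ t, (V t).det = _ := fun t => (clm_det_eq (V t)).trans (Matrix.det_fin_three _)
    simp only [Matrix.of_apply] at hexp
    refine (this.congr (fun s _ => hexp s) (hexp t)).congr_deriv ?_
    have htr' := htr t ht
    simp only [Fin.sum_univ_three] at htr' ⊢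
    generalize A t (EuclideanSpace.single 2 1) 2 = a22 at *
    obtain rfl : a22 = - (A t (EuclideanSpace.single 0 1) 0 + A t (EuclideanSpace.single 1 1) 1) := by
      linarith
    ring
  intro t ht
  have := constant_of_has_deriv_right_zero (fun t ht => (hdet t ht).continuousWithinAt)
    (fun t ht => (hdet t (Ico_subset_Icc_self ht)).mono_of_mem_nhdsWithin
      (mem_of_superset (Icc_mem_nhdsGE ht.2) (Icc_subset_Icc_left ht.1))) t ht
  rw [this, hV0]
  simp [ContinuousLinearMap.det]

end Determinant

/-- The flow of a compactly supported `C¹` field preserves volume infinitesimally along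
trajectories on which the divergence vanishes. -/
theorem IsFlow.exists_hasFDerivAt_det_eq_one {v : E3 → E3} {Φ : ℝ → E3 → E3} (hΦ : IsFlow v Φ)
    (hv : ContDiff ℝ 1 v) (hc : HasCompactSupport v) {x : E3} {T : ℝ} (hT : 0 ≤ T)
    (hdiv : ∀ t ∈ Icc 0 T, divergence v (Φ t x) = 0) :
    ∃ V : E3 →L[ℝ] E3, HasFDerivAt (Φ T) V x ∧ V.det = 1 := by
  obtain ⟨L, hL⟩ := hv.lipschitzWith_of_hasCompactSupport hc one_ne_zero
  -- A step length for which the linearized equation is solvable from any starting point; longer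
  -- times are reached by composing steps, and determinants multiply.
  set τ : ℝ := 1 / (2 * L + 1) with hτ
  have hτ0 : 0 < τ := by positivity
  have hshort : ∀ (y : E3) (S : ℝ), 0 ≤ S → S ≤ τ →
      (∀ t ∈ Icc 0 S, divergence v (Φ t y) = 0) →
      ∃ V : E3 →L[ℝ] E3, HasFDerivAt (Φ S) V y ∧ V.det = 1 := by
    intro y S hS hSτ hdivS
    have hLS : 2 * L * S ≤ 1 := by
      have : (2 * L + 1) * S ≤ (2 * L + 1) * τ := by gcongr
      rw [hτ, mul_one_div_cancel (by positivity)] at this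
      linarith
    obtain ⟨V, hV0, hV⟩ := exists_linear_ode_solution
      (A := fun t => fderiv ℝ v (Φ t y)) (L := L)
      ((hv.continuous_fderiv one_ne_zero).comp (hΦ.continuous_time y))
      (fun t => norm_fderiv_le_of_lipschitz ℝ hL) hS hLS
    exact ⟨V S, hΦ.hasFDerivAt_of_linear_ode hv hc hS hV0 hV,
      det_eq_one_of_linear_ode hV0 hV hdivS S ⟨hS, le_rfl⟩⟩
  have hind : ∀ (n : ℕ) (S : ℝ), 0 ≤ S → S ≤ n * τ →
      (∀ t ∈ Icc 0 S, divergence v (Φ t x) = 0) →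
      ∃ V : E3 →L[ℝ] E3, HasFDerivAt (Φ S) V x ∧ V.det = 1 := by
    intro n
    induction n with
    | zero =>
      intro S hS hSn hd
      exact hshort x S hS (by simp at hSn; linarith) hd
    | succ n ih =>
      intro S hS hSn hd
      by_cases hSτ : S ≤ τ
      · exact hshort x S hS hSτ hd
      push Not at hSτ
      push_cast at hSn
      obtain ⟨V, hV, hVdet⟩ := ih (S - τ) (by linarith) (by linarith)
        (fun t ht => hd t ⟨ht.1, by linarith [ht.2]⟩)
      obtain ⟨W, hW, hWdet⟩ := hshort (Φ (S - τ) x) τ hτ0.le le_rfl (fun t ht => by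
        rw [← hΦ.add hL]
        exact hd _ ⟨by linarith [ht.1], by linarith [ht.2]⟩)
      refine ⟨W.comp V, ?_, by rw [clm_det_comp, hVdet, hWdet, one_mul]⟩
      have h : Φ S = Φ τ ∘ Φ (S - τ) := by
        funext y
        rw [Function.comp_apply, ← hΦ.add hL]
        congr 1
        ring
      rw [h]
      exact hW.comp x hV
  obtain ⟨n, hn⟩ := exists_nat_ge (T / τ)
  exact hind n T hT ((div_le_iff₀ hτ0).1 hn) hdiv

/-! ### The radial map and its Jacobian. -/

theorem hasFDerivAt_norm_of_ne_zero {x : E3} (hx : x ≠ 0) :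
    HasFDerivAt (fun y : E3 => ‖y‖) (innerSL ℝ (unitNormal x)) x := by
  have h := (hasStrictFDerivAt_norm_sq x).hasFDerivAt.sqrt (by positivity)
  have hfun : (fun y : E3 => ‖y‖) = fun y => √(‖y‖ ^ 2) := by
    funext y
    rw [Real.sqrt_sq (norm_nonneg y)]
  rw [hfun]
  convert! h using 1
  rw [Real.sqrt_sq (norm_nonneg x), unitNormal, map_smul, ← Nat.cast_smul_eq_nsmul ℝ 2, smul_smul]
  congr 1
  push_cast
  field_simp

/-- The map sending `t ω`, with `|ω| = 1`, to the position at time `t` of the trajectory that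
starts at `α ω`. -/
noncomputable def IsFlow.radialMap (Φ : ℝ → E3 → E3) (α : ℝ) (x : E3) : E3 := Φ ‖x‖ (α • unitNormal x)

theorem hasFDerivAt_smul_unitNormal (α : ℝ) {x : E3} (hx : x ≠ 0) :
    HasFDerivAt (fun y : E3 => α • unitNormal y)
      ((α / ‖x‖) • ContinuousLinearMap.id ℝ E3 +
        (innerSL ℝ (unitNormal x)).smulRight (-(α / ‖x‖) • unitNormal x)) x := by
  have hx' : ‖x‖ ≠ 0 := norm_ne_zero_iff.2 hx
  have h1 := (hasDerivAt_inv hx').comp_hasFDerivAt x (hasFDerivAt_norm_of_ne_zero hx)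
  have h2 := (h1.smul (hasFDerivAt_id x)).const_smul α
  convert! h2 using 1
  ext y i
  simp [unitNormal]
  field_simp

theorem norm_unitNormal {x : E3} (hx : x ≠ 0) : ‖unitNormal x‖ = 1 := by
  rw [unitNormal, norm_smul, norm_inv, norm_norm, inv_mul_cancel₀ (norm_ne_zero_iff.2 hx)]

/-- The Jacobian determinant of the radial map. -/
theorem IsFlow.exists_hasFDerivAt_radialMap {v : E3 → E3} {Φ : ℝ → E3 → E3} (hΦ : IsFlow v Φ)
    (hv : ContDiff ℝ 1 v) (hc : HasCompactSupport v) (α : ℝ) {x : E3} (hx : x ≠ 0)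
    (hdiv : ∀ t ∈ Icc 0 ‖x‖, divergence v (Φ t (α • unitNormal x)) = 0) :
    ∃ W : E3 →L[ℝ] E3, HasFDerivAt (IsFlow.radialMap Φ α) W x ∧
      W.det = (α / ‖x‖) ^ 2 * inner ℝ (unitNormal x) (v (α • unitNormal x)) := by
  obtain ⟨K, hK⟩ := hv.lipschitzWith_of_hasCompactSupport hc one_ne_zero
  obtain ⟨V, hV, hVdet⟩ := hΦ.exists_hasFDerivAt_det_eq_one hv hc (norm_nonneg x) hdiv
  set ω := unitNormal x with hω
  set c := α / ‖x‖ with hc'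
  refine ⟨V.comp (c • ContinuousLinearMap.id ℝ E3 +
    (innerSL ℝ ω).smulRight (v (α • ω) - c • ω)), ?_, ?_⟩
  · have hη := hV.comp x (hasFDerivAt_smul_unitNormal α hx)
    have hτ := (hasFDerivAt_norm_of_ne_zero hx).sub_const ‖x‖
    have hG := hΦ.hasFDerivAt_zero hK (Φ ‖x‖ (α • ω))
    have hpair := hτ.prodMk hη
    have hcomp := HasFDerivAt.comp x (by simpa using hG) hpair
    -- The group law splits off `Φ ‖x‖`, so joint differentiability in time and space is needed only
    -- at time zero. As `V` carries `v (α • ω)` to the velocity at the endpoint, `V` factors out of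
    -- the whole derivative.
    have hfun : IsFlow.radialMap Φ α =
        (fun p : ℝ × E3 => Φ p.1 p.2) ∘
          fun y => (‖y‖ - ‖x‖, (Φ ‖x‖ ∘ fun y => α • unitNormal y) y) := by
      funext y
      simp only [Function.comp_apply, ← hΦ.add hK, sub_add_cancel]
      rfl
    rw [hfun]
    convert! hcomp using 1
    ext1 y
    simp only [ContinuousLinearMap.comp_apply, add_apply,
      smul_apply, ContinuousLinearMap.smulRight_apply,
      ContinuousLinearMap.prod_apply, ContinuousLinearMap.coe_fst',
      ContinuousLinearMap.coe_snd', ContinuousLinearMap.id_apply, map_add, map_smul, map_sub, map_neg,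
      hΦ.fderiv_apply_field hK hV, ← hω, ← hc', smul_sub, neg_smul, smul_neg]
    abel
  · rw [clm_det_comp, hVdet, one_mul, clm_det_smul_id_add_smulRight, inner_sub_right,
      inner_smul_right, real_inner_self_eq_norm_sq, hω, norm_unitNormal hx]
    ring


/-! ### Shell crossings and polar coordinates. -/

/-- The open spherical shell with inner radius `r` and outer radius `2 r`. -/
def shell (r : ℝ) : Set E3 := {x | r < ‖x‖ ∧ ‖x‖ < 2 * r}

theorem isOpen_shell (r : ℝ) : IsOpen (shell r) :=
  (isOpen_lt continuous_const continuous_norm).inter (isOpen_lt continuous_norm continuous_const)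

/-- An integral curve crossing a shell has length at least the thickness of the shell within it. -/
theorem le_lintegral_shell {v : E3 → E3} {γ : ℝ → E3}
    (hγ : ∀ t, HasDerivAt γ (v (γ t)) t) (hv : Continuous v) {r s : ℝ} (hs : 0 ≤ s)
    (h0 : 2 * r ≤ ‖γ 0‖) (h1 : ‖γ s‖ ≤ r) :
    ENNReal.ofReal r ≤ ∫⁻ t in Ioo 0 s, (shell r).indicator (fun x => ‖v x‖ₑ) (γ t) := by
  have hc : Continuous γ := continuous_iff_continuousAt.2 fun t => (hγ t).continuousAt
  -- `t₁` is the last time outside the shell's outer radius, and `t₂` the first later time at or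
  -- below the inner one; between them the curve lies in the shell.
  obtain ⟨t₁, ⟨ht₁, hn₁⟩, hmax⟩ := (isCompact_Icc.inter_right
    (isClosed_le continuous_const hc.norm : IsClosed {t | 2 * r ≤ ‖γ t‖})).exists_isGreatest
    ⟨0, ⟨le_rfl, hs⟩, h0⟩
  obtain ⟨t₂, ⟨ht₂, hn₂⟩, hmin⟩ := (isCompact_Icc.inter_right
    (isClosed_le hc.norm continuous_const : IsClosed {t | ‖γ t‖ ≤ r})).exists_isLeast
    (⟨s, ⟨ht₁.2, le_rfl⟩, h1⟩ : (Icc t₁ s ∩ {t | ‖γ t‖ ≤ r}).Nonempty)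
  have hn₁' : 2 * r ≤ ‖γ t₁‖ := hn₁
  have hn₂' : ‖γ t₂‖ ≤ r := hn₂
  have hshell : ∀ t ∈ Ioo t₁ t₂, γ t ∈ shell r := by
    intro t ht
    constructor
    · by_contra! h
      exact absurd (hmin ⟨⟨ht.1.le, ht.2.le.trans ht₂.2⟩, h⟩) (not_le.2 ht.2)
    · by_contra! h
      exact absurd (hmax ⟨⟨ht₁.1.trans ht.1.le, ht.2.le.trans ht₂.2⟩, h⟩) (not_le.2 ht.1)
  have hvc : Continuous fun t => v (γ t) := hv.comp hc
  have hint : ∫ t in t₁..t₂, v (γ t) = γ t₂ - γ t₁ :=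
    intervalIntegral.integral_eq_sub_of_hasDerivAt (fun t _ => hγ t) (hvc.intervalIntegrable _ _)
  have hnorm : r ≤ ‖γ t₂ - γ t₁‖ := by
    have := norm_sub_norm_le (γ t₁) (γ t₂)
    rw [norm_sub_rev] at this
    linarith
  calc ENNReal.ofReal r ≤ ENNReal.ofReal ‖γ t₂ - γ t₁‖ := ENNReal.ofReal_le_ofReal hnorm
    _ = ‖∫ t in Ioc t₁ t₂, v (γ t)‖ₑ := by
      rw [← hint, intervalIntegral.integral_of_le ht₂.1, ofReal_norm]
    _ ≤ ∫⁻ t in Ioc t₁ t₂, ‖v (γ t)‖ₑ := enorm_integral_le_lintegral_enorm _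
    _ = ∫⁻ t in Ioo t₁ t₂, ‖v (γ t)‖ₑ := by rw [restrict_Ioo_eq_restrict_Ioc]
    _ = ∫⁻ t in Ioo t₁ t₂, (shell r).indicator (fun x => ‖v x‖ₑ) (γ t) :=
      setLIntegral_congr_fun measurableSet_Ioo fun t ht => by
        simp only [indicator_of_mem (hshell t ht)]
    _ ≤ _ := lintegral_mono_set (Ioo_subset_Ioo ht₁.1 ht₂.2)

/-- Integration in polar coordinates in three-space. -/
theorem lintegral_polar {h : E3 → ENNReal} (hh : Measurable h) :
    ∫⁻ x, h x = ∫⁻ ω : Metric.sphere (0 : E3) 1, (∫⁻ t in Ioi (0 : ℝ),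
      ENNReal.ofReal (t ^ 2) * h (t • (ω : E3))) ∂(volume : Measure E3).toSphere := by
  have hmp := (volume : Measure E3).measurePreserving_homeomorphUnitSphereProd
  have hdim : Module.finrank ℝ E3 - 1 = 2 := by simp
  rw [hdim] at hmp
  have hsm : Measurable fun p : Metric.sphere (0 : E3) 1 × Ioi (0 : ℝ) =>
      h ((p.2 : ℝ) • (p.1 : E3)) := by
    refine hh.comp ?_
    exact ((measurable_subtype_coe.comp measurable_snd).smul
      (measurable_subtype_coe.comp measurable_fst))
  calc ∫⁻ x, h x = ∫⁻ x in ({0}ᶜ : Set E3), h x := by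
        rw [Measure.restrict_eq_self_of_ae_mem]
        exact compl_mem_ae_iff.2 (measure_singleton _)
    _ = ∫⁻ x : ({0}ᶜ : Set E3), h x ∂(volume : Measure E3).comap (↑) :=
        (lintegral_subtype_comap (measurableSet_singleton _).compl h).symm
    _ = ∫⁻ p : Metric.sphere (0 : E3) 1 × Ioi (0 : ℝ), h ((p.2 : ℝ) • (p.1 : E3))
          ∂((volume : Measure E3).toSphere.prod (Measure.volumeIoiPow 2)) := by
        rw [← hmp.lintegral_comp hsm]
        refine lintegral_congr fun x => ?_
        congr 1
        have hx : ‖(x : E3)‖ ≠ 0 := norm_ne_zero_iff.2 x.2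
        simp [smul_smul, hx]
    _ = _ := by
        rw [lintegral_prod _ hsm.aemeasurable]
        refine lintegral_congr fun ω => ?_
        have hω : Measurable fun t : Ioi (0 : ℝ) => h ((t : ℝ) • (ω : E3)) :=
          hsm.comp (measurable_const.prodMk measurable_id)
        rw [Measure.volumeIoiPow, lintegral_withDensity_eq_lintegral_mul _
          (by fun_prop) hω]
        exact lintegral_subtype_comap measurableSet_Ioi
          (fun t : ℝ => ENNReal.ofReal (t ^ 2) * h (t • (ω : E3)))

theorem unitNormal_smul_sphere {t : ℝ} (ht : 0 < t) (ω : Metric.sphere (0 : E3) 1) :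
    unitNormal (t • (ω : E3)) = ω := by
  have hω : ‖(ω : E3)‖ = 1 := by simp
  rw [unitNormal, norm_smul, hω, mul_one, Real.norm_of_nonneg ht.le, smul_smul,
    inv_mul_cancel₀ ht.ne', one_smul]

theorem measurable_unitNormal : Measurable unitNormal :=
  measurable_norm.inv.smul measurable_id

theorem setLIntegral_sphereMeasure {α : ℝ} {A : Set E3} (hA : MeasurableSet A)
    {f : E3 → ENNReal} (hf : Measurable f) :
    ∫⁻ η in A, f η ∂sphereMeasure α = ENNReal.ofReal (α ^ 2) *
      ∫⁻ ω in (fun ω : Metric.sphere (0 : E3) 1 => α • (ω : E3)) ⁻¹' A, f (α • (ω : E3))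
        ∂(volume : Measure E3).toSphere := by
  rw [sphereMeasure, Measure.restrict_smul, lintegral_smul_measure,
    setLIntegral_map hA hf (by fun_prop), smul_eq_mul]

/-! ### Measurability of the entering set and the flux bound for a global flow. -/

namespace IsFlow

/-- The pairs `(t, x)` such that the trajectory of `x` stays in `O` up to time `t` and in the open
ball of radius `α` at positive times. -/
def tube (Φ : ℝ → E3 → E3) (O : Set E3) (α : ℝ) : Set (ℝ × E3) :=
  {p | 0 < p.1 ∧ (∀ t ∈ Icc 0 p.1, Φ t p.2 ∈ O) ∧ ∀ t ∈ Ioc 0 p.1, Φ t p.2 ∈ Metric.ball 0 α}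

/-- Rescaling time makes the interval a fixed compact set, so a tube-lemma argument applies. -/
theorem isOpen_forall_Icc_mul {X : Type*} [TopologicalSpace X] {f : ℝ × X → E3} (hf : Continuous f)
    {O : Set E3} (hO : IsOpen O) (a b : ℝ) :
    IsOpen {p : ℝ × X | ∀ θ ∈ Icc a b, f (θ * p.1, p.2) ∈ O} := by
  rw [isOpen_iff_mem_nhds]
  intro p hp
  refine isCompact_Icc.eventually_forall_of_forall_eventually fun θ hθ => ?_
  have hc : Continuous fun q : (ℝ × X) × ℝ => f (q.2 * q.1.1, q.1.2) := by fun_prop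
  exact hc.continuousAt.eventually_mem (hO.mem_nhds (hp θ hθ))

theorem measurableSet_tube {Φ : ℝ → E3 → E3} (hΦ : Continuous fun p : ℝ × E3 => Φ p.1 p.2)
    {O : Set E3} (hO : IsOpen O) (α : ℝ) : MeasurableSet (tube Φ O α) := by
  have heq : tube Φ O α = {p | 0 < p.1} ∩ ({p | ∀ θ ∈ Icc (0 : ℝ) 1, Φ (θ * p.1) p.2 ∈ O} ∩
      -- The half-open time interval, which excludes the start on the sphere, is exhausted by
      -- compact ones.
      ⋂ n : ℕ, {p | ∀ θ ∈ Icc (1 / ((n : ℝ) + 1)) 1, Φ (θ * p.1) p.2 ∈ Metric.ball 0 α}) := by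
    ext ⟨s, x⟩
    simp only [tube, mem_ofPred_eq, mem_inter_iff, mem_iInter]
    refine and_congr_right fun hs => and_congr ⟨fun h θ hθ => h _ ⟨by have := hθ.1; positivity,
      mul_le_of_le_one_left hs.le hθ.2⟩, fun h t ht => ?_⟩ ⟨fun h n θ hθ => h _ ⟨?_,
      mul_le_of_le_one_left hs.le hθ.2⟩, fun h t ht => ?_⟩
    · have := h (t / s) ⟨div_nonneg ht.1 hs.le, (div_le_one hs).2 ht.2⟩
      rwa [div_mul_cancel₀ _ hs.ne'] at this
    · have : 0 < θ := lt_of_lt_of_le (by positivity) hθ.1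
      positivity
    · obtain ⟨n, hn⟩ := exists_nat_one_div_lt (div_pos ht.1 hs)
      have := h n (t / s) ⟨hn.le, (div_le_one hs).2 ht.2⟩
      rwa [div_mul_cancel₀ _ hs.ne'] at this
  rw [heq]
  exact (isOpen_lt continuous_const continuous_fst).measurableSet.inter
    ((isOpen_forall_Icc_mul hΦ hO 0 1).measurableSet.inter
      (MeasurableSet.iInter fun n => (isOpen_forall_Icc_mul hΦ Metric.isOpen_ball _ 1).measurableSet))

variable {u v : E3 → E3} {Φ : ℝ → E3 → E3} {O : Set E3} {α r : ℝ}

/-- The entering set in terms of a flow that agrees with the streamlines on `O`. -/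
theorem enteringSet_eq (hΦ : IsFlow v Φ) (hv : ContDiff ℝ 1 v) (hc : HasCompactSupport v)
    (hO0 : (0 : E3) ∉ O) (huv : EqOn u v O) :
    enteringSet O u α r = Metric.sphere 0 α ∩
      ⋃ q : ℚ, {η | ((q : ℝ), η) ∈ tube Φ O α ∧ Φ q η ∈ Metric.ball 0 r} := by
  obtain ⟨K, hK⟩ := hv.lipschitzWith_of_hasCompactSupport hc one_ne_zero
  ext η
  simp only [enteringSet, mem_ofPred_eq, mem_inter_iff, mem_iUnion]
  refine and_congr_right fun _ => ⟨?_, ?_⟩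
  · rintro ⟨s, hs, γ, hγ, hγs, hball⟩
    have heq : ∀ t ∈ Icc 0 s, γ t = Φ t η := by
      have := hΦ.eq_of_hasDerivWithinAt hK (γ := γ) (s := s) fun t ht => by
        rw [← huv (hγ.mem_domain t ht).1]
        exact hγ.hasDeriv t ht
      rwa [hγ.start] at this
    have hs' : Φ s η ∈ Metric.ball 0 r := by rwa [← heq s ⟨hs.le, le_rfl⟩]
    -- Being in the open ball of radius `r` persists slightly before `s`, so a rational time serves;
    -- this makes the union countable. Stopping before `s` also puts the endpoint inside the
    -- `α`-ball.
    have hnear : ∀ᶠ t in 𝓝[<] s, Φ t η ∈ Metric.ball 0 r :=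
      ((hΦ.continuous_time η).continuousAt.eventually_mem
        (Metric.isOpen_ball.mem_nhds hs')).filter_mono nhdsWithin_le_nhds
    obtain ⟨a, ha, hlt⟩ := (mem_nhdsLT_iff_exists_Ioo_subset' hs).1
      (hnear.and (Ioo_mem_nhdsLT hs))
    obtain ⟨q, hq₁, hq₂⟩ := exists_rat_btwn (show a < s from ha)
    obtain ⟨hqr, hq0, hqs⟩ := hlt ⟨hq₁, hq₂⟩
    refine ⟨q, ⟨hq0, fun t ht => ?_, fun t ht => ?_⟩, hqr⟩
    · have ht' : t ∈ Icc 0 s := ⟨ht.1, ht.2.trans hqs.le⟩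
      rw [← heq t ht']
      exact (hγ.mem_domain t ht').1
    · have ht' : t ∈ Ioo 0 s := ⟨ht.1, lt_of_le_of_lt ht.2 hqs⟩
      rw [← heq t (Ioo_subset_Icc_self ht')]
      exact hball t ht'
  · rintro ⟨q, ⟨hq, hqO, hqB⟩, hqr⟩
    refine ⟨q, hq, fun t => Φ t η, ⟨hΦ.zero η, fun t ht => ⟨hqO t ht, fun h => ?_⟩, fun t ht => ?_⟩,
      hqr, fun t ht => hqB t ⟨ht.1, ht.2.le⟩⟩
    · exact hO0 (h ▸ hqO t ht)
    · rw [huv (hqO t ht)]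
      exact (hΦ.deriv η t).hasDerivWithinAt

theorem measurableSet_enteringSet (hΦ : IsFlow v Φ) (hv : ContDiff ℝ 1 v)
    (hc : HasCompactSupport v) (hO : IsOpen O) (hO0 : (0 : E3) ∉ O) (huv : EqOn u v O) :
    MeasurableSet (enteringSet O u α r) := by
  obtain ⟨K, hK⟩ := hv.lipschitzWith_of_hasCompactSupport hc one_ne_zero
  rw [hΦ.enteringSet_eq hv hc hO0 huv]
  refine Metric.isClosed_sphere.measurableSet.inter (MeasurableSet.iUnion fun q => ?_)
  have hcont := hΦ.continuous_uncurry hK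
  have hm : Measurable fun η : E3 => ((q : ℝ), η) := measurable_const.prodMk measurable_id
  have hq : Continuous fun η : E3 => Φ q η := hcont.comp (Continuous.prodMk_right (q : ℝ))
  have h1 : MeasurableSet {η : E3 | ((q : ℝ), η) ∈ tube Φ O α} :=
    hm (measurableSet_tube hcont hO α)
  have h2 : MeasurableSet {η : E3 | Φ q η ∈ Metric.ball (0 : E3) r} :=
    hq.measurable measurableSet_ball
  exact h1.inter h2

/-- The points `t ω`, `|ω| = 1`, such that the trajectory of `α ω` is in the tube at time `t`. -/
def radialDomain (Φ : ℝ → E3 → E3) (O : Set E3) (α : ℝ) : Set E3 :=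
  {x | (‖x‖, α • unitNormal x) ∈ tube Φ O α}

/-- If two trajectories meet at different elapsed times, one starting point lies on the other
trajectory at a positive time. That is impossible: starting points have norm `α`, while the tube
forces norm below `α` at positive times. -/
theorem injOn_radialMap (hΦ : IsFlow v Φ) {K : NNReal} (hK : LipschitzWith K v) (hα : 0 < α) :
    InjOn (radialMap Φ α) (radialDomain Φ O α) := by
  have key : ∀ x ∈ radialDomain Φ O α, ∀ y ∈ radialDomain Φ O α, ‖x‖ ≤ ‖y‖ →
      radialMap Φ α x = radialMap Φ α y → x = y := by
    intro x hx y hy hle hxy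
    have hx0 : x ≠ 0 := norm_pos_iff.1 hx.1
    have hy0 : y ≠ 0 := norm_pos_iff.1 hy.1
    have hstart : α • unitNormal x = Φ (‖y‖ - ‖x‖) (α • unitNormal y) := by
      have := congrArg (Φ (-‖x‖)) hxy
      rw [radialMap, radialMap, ← hΦ.add hK, ← hΦ.add hK, neg_add_cancel, hΦ.zero] at this
      rw [this, neg_add_eq_sub]
    have hnorm : ‖x‖ = ‖y‖ := by
      by_contra hne
      have := hy.2.2 (‖y‖ - ‖x‖) ⟨sub_pos.2 (lt_of_le_of_ne hle hne),
        sub_le_self _ (norm_nonneg x)⟩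
      rw [← hstart, mem_ball_zero_iff, norm_smul, norm_unitNormal hx0,
        Real.norm_of_nonneg hα.le, mul_one] at this
      exact lt_irrefl _ this
    rw [hnorm, sub_self, hΦ.zero] at hstart
    have hun : unitNormal x = unitNormal y := smul_right_injective _ hα.ne' hstart
    rw [unitNormal, unitNormal, hnorm] at hun
    exact smul_right_injective _ (inv_ne_zero (norm_ne_zero_iff.2 hy0)) hun
  intro x hx y hy hxy
  rcases le_total ‖x‖ ‖y‖ with h | h
  · exact key x hx y hy h hxy
  · exact (key y hy x hx h hxy.symm).symm

/-- The flux through the entering set is controlled by the integral over the shell. -/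
theorem mul_setLIntegral_enteringSet_le (hΦ : IsFlow v Φ) (hv : ContDiff ℝ 1 v)
    (hc : HasCompactSupport v) (hO : IsOpen O) (hO0 : (0 : E3) ∉ O) (huv : EqOn u v O)
    (hdiv : ∀ x ∈ O, divergence v x = 0) (hα : 0 < α) (hrα : 2 * r ≤ α) :
    ENNReal.ofReal r *
        ∫⁻ η in enteringSet O u α r, ‖inner ℝ (v η) (unitNormal η)‖ₑ ∂sphereMeasure α ≤
      ∫⁻ x in O, (shell r).indicator (fun x => ‖v x‖ₑ) x := by
  obtain ⟨K, hK⟩ := hv.lipschitzWith_of_hasCompactSupport hc one_ne_zero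
  have hcont := hΦ.continuous_uncurry hK
  set F : E3 → ENNReal := (shell r).indicator fun x => ‖v x‖ₑ with hF
  have hFm : Measurable F := hv.continuous.enorm.measurable.indicator (isOpen_shell r).measurableSet
  set U := radialDomain Φ O α with hU
  have hpair : Measurable fun x : E3 => (‖x‖, α • unitNormal x) :=
    measurable_norm.prodMk (measurable_unitNormal.const_smul α)
  have hUm : MeasurableSet U := (measurableSet_tube hcont hO α).preimage hpair
  have hder : ∀ x ∈ U, ∃ W : E3 →L[ℝ] E3, HasFDerivAt (radialMap Φ α) W x ∧
      W.det = (α / ‖x‖) ^ 2 * inner ℝ (unitNormal x) (v (α • unitNormal x)) := fun x hx =>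
    hΦ.exists_hasFDerivAt_radialMap hv hc α (norm_pos_iff.1 hx.1) fun t ht => hdiv _ (hx.2.1 t ht)
  choose! W hW hWdet using hder
  set J : E3 → ENNReal := fun x =>
    ENNReal.ofReal |(α / ‖x‖) ^ 2 * inner ℝ (unitNormal x) (v (α • unitNormal x))| with hJ
  have hJm : Measurable J := by
    have h1 : Measurable fun x : E3 => v (α • unitNormal x) :=
      hv.continuous.measurable.comp (measurable_unitNormal.const_smul α)
    have h2 : Measurable fun x : E3 => (α / ‖x‖) ^ 2 := by fun_prop
    have h3 := h2.mul (measurable_unitNormal.inner h1 (𝕜 := ℝ))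
    exact (continuous_abs.measurable.comp h3).ennreal_ofReal
  have hΘm : Measurable (radialMap Φ α) := hcont.measurable.comp hpair
  have hΘO : radialMap Φ α '' U ⊆ O := by
    rintro _ ⟨x, hx, rfl⟩
    exact hx.2.1 ‖x‖ ⟨norm_nonneg x, le_rfl⟩
  -- Change of variables along the injective radial map, whose image lies in `O`.
  have hvolume : ∫⁻ x, U.indicator (fun x => J x * F (radialMap Φ α x)) x ≤ ∫⁻ x in O, F x := by
    rw [lintegral_indicator hUm]
    refine le_trans (le_of_eq ?_) (lintegral_mono_set hΘO)
    rw [lintegral_image_eq_lintegral_abs_det_fderiv_mul volume hUm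
      (fun x hx => (hW x hx).hasFDerivWithinAt) (hΦ.injOn_radialMap hK hα)]
    refine setLIntegral_congr_fun hUm fun x hx => ?_
    simp only [hWdet x hx, hJ]
  refine le_trans ?_ hvolume
  have hAm : MeasurableSet (enteringSet O u α r) :=
    hΦ.measurableSet_enteringSet hv hc hO hO0 huv
  have hfm : Measurable fun η : E3 => ‖inner ℝ (v η) (unitNormal η)‖ₑ :=
    (hv.continuous.measurable.inner measurable_unitNormal (𝕜 := ℝ)).enorm
  have hAm' : MeasurableSet
      ((fun ω : Metric.sphere (0 : E3) 1 => α • (ω : E3)) ⁻¹' enteringSet O u α r) :=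
    hAm.preimage (by fun_prop)
  have hgm : Measurable (U.indicator fun x => J x * F (radialMap Φ α x)) :=
    (hJm.mul (hFm.comp hΘm)).indicator hUm
  rw [lintegral_polar hgm, setLIntegral_sphereMeasure hAm hfm,
    ← lintegral_const_mul' _ _ ENNReal.ofReal_ne_top, ← lintegral_const_mul' _ _ ENNReal.ofReal_ne_top]
  refine le_trans (setLIntegral_mono' hAm' fun ω hω => ?_) (setLIntegral_le_lintegral _ _)
  rw [mem_preimage, hΦ.enteringSet_eq hv hc hO0 huv] at hω
  obtain ⟨q, ⟨hq, hqO, hqB⟩, hqr⟩ := mem_iUnion.1 hω.2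
  have hω1 : ‖(ω : E3)‖ = 1 := by simp
  have hcross : ENNReal.ofReal r ≤ ∫⁻ t in Ioo 0 (q : ℝ), F (Φ t (α • (ω : E3))) := by
    refine le_lintegral_shell (v := v) (γ := fun t => Φ t (α • (ω : E3))) (hΦ.deriv _)
      hv.continuous hq.le ?_ (mem_ball_zero_iff.1 hqr).le
    rw [hΦ.zero, norm_smul, hω1, mul_one, Real.norm_of_nonneg hα.le]
    exact hrα
  rw [unitNormal_smul_sphere hα]
  calc _ = ENNReal.ofReal (α ^ 2) * ‖inner ℝ (v (α • (ω : E3))) (ω : E3)‖ₑ * ENNReal.ofReal r := by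
        ring
    _ ≤ ENNReal.ofReal (α ^ 2) * ‖inner ℝ (v (α • (ω : E3))) (ω : E3)‖ₑ *
          ∫⁻ t in Ioo 0 (q : ℝ), F (Φ t (α • (ω : E3))) := by gcongr
    _ = ∫⁻ t in Ioo 0 (q : ℝ), ENNReal.ofReal (α ^ 2) *
          ‖inner ℝ (v (α • (ω : E3))) (ω : E3)‖ₑ * F (Φ t (α • (ω : E3))) := by
        rw [lintegral_const_mul' _ _ (ENNReal.mul_ne_top ENNReal.ofReal_ne_top enorm_ne_top)]
    _ ≤ ∫⁻ t in Ioo 0 (q : ℝ), ENNReal.ofReal (t ^ 2) *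
          U.indicator (fun x => J x * F (radialMap Φ α x)) (t • (ω : E3)) := by
        refine setLIntegral_mono' measurableSet_Ioo fun t ht => ?_
        have hun := unitNormal_smul_sphere ht.1 ω
        have hnt : ‖t • (ω : E3)‖ = t := by
          rw [norm_smul, hω1, mul_one, Real.norm_of_nonneg ht.1.le]
        have hmem : t • (ω : E3) ∈ U := by
          refine ⟨?_, fun s hs => ?_, fun s hs => ?_⟩
          · simpa only [hnt] using ht.1
          · simp only [hnt, hun] at hs ⊢
            exact hqO s ⟨hs.1, hs.2.trans ht.2.le⟩
          · simp only [hnt, hun] at hs ⊢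
            exact hqB s ⟨hs.1, hs.2.trans ht.2.le⟩
        rw [indicator_of_mem hmem]
        simp only [hJ, radialMap, hnt, hun]
        -- The polar weight `t ^ 2` cancels the denominator of the Jacobian, leaving the surface
        -- factor `α ^ 2`.
        rw [← mul_assoc, ← ENNReal.ofReal_mul (sq_nonneg t), ← ofReal_norm,
          ← ENNReal.ofReal_mul (sq_nonneg α), abs_mul, abs_of_nonneg (sq_nonneg (α / t)),
          ← mul_assoc, ← mul_pow, mul_div_cancel₀ _ ht.1.ne', Real.norm_eq_abs, real_inner_comm]
    _ ≤ _ := lintegral_mono_set Ioo_subset_Ioi_self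

end IsFlow


/-! ### Cutoff and exhaustion: from global flows to the field on `D \ {0}`. -/

/-- A `C¹` map on an open set agrees on any given compact subset with a compactly supported `C¹`
map. -/
theorem ContDiffOn.exists_hasCompactSupport_eqOn {u : E3 → E3} {Ω K : Set E3}
    (hu : ContDiffOn ℝ 1 u Ω) (hΩ : IsOpen Ω) (hK : IsCompact K) (hKΩ : K ⊆ Ω) :
    ∃ v : E3 → E3, ContDiff ℝ 1 v ∧ HasCompactSupport v ∧ EqOn u v K := by
  obtain ⟨L, hL, hKL, hLΩ⟩ := exists_compact_between hK hΩ hKΩ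
  obtain ⟨f, hf1, hf0, -⟩ := exists_contMDiffMap_one_nhds_of_subset_interior
    (n := 1) (modelWithCornersSelf ℝ E3) hK.isClosed hKL
  have hfc : ContDiff ℝ 1 f := f.contMDiff.contDiff
  refine ⟨fun x => f x • u x, ?_, HasCompactSupport.intro hL fun x hx => ?_, fun x hx => ?_⟩
  · rw [contDiff_iff_contDiffAt]
    intro x
    by_cases hx : x ∈ Ω
    · exact hfc.contDiffAt.smul ((hu x hx).contDiffAt (hΩ.mem_nhds hx))
    · refine contDiffAt_const (c := (0 : E3)) |>.congr_of_eventuallyEq ?_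
      filter_upwards [hL.isClosed.isOpen_compl.mem_nhds fun h => hx (hLΩ h)] with y hy
      rw [hf0 y hy, zero_smul]
  · simp only [hf0 x hx, zero_smul]
  · have : f x = 1 := hf1.self_of_nhdsSet x hx
    simp only [this, one_smul]

/-- The points of the ball of radius `n + 1` at distance more than `1 / (n + 1)` from the
complement of `Ω`. -/
def innerExhaustion (Ω : Set E3) (n : ℕ) : Set E3 :=
  {x | 1 / ((n : ℝ) + 1) < Metric.infDist x Ωᶜ} ∩ Metric.ball 0 (n + 1)

theorem isOpen_innerExhaustion (Ω : Set E3) (n : ℕ) : IsOpen (innerExhaustion Ω n) :=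
  (isOpen_lt continuous_const (Metric.continuous_infDist_pt _)).inter Metric.isOpen_ball

theorem monotone_innerExhaustion (Ω : Set E3) : Monotone (innerExhaustion Ω) := by
  intro n m hnm x hx
  have h1 : 1 / ((n : ℝ) + 1) < Metric.infDist x Ωᶜ := hx.1
  have h2 : 1 / ((m : ℝ) + 1) < Metric.infDist x Ωᶜ := (Nat.one_div_le_one_div hnm).trans_lt h1
  exact ⟨h2, Metric.ball_subset_ball (by gcongr) hx.2⟩

theorem exists_isCompact_innerExhaustion_subset (Ω : Set E3) (n : ℕ) :
    ∃ K, IsCompact K ∧ innerExhaustion Ω n ⊆ K ∧ K ⊆ Ω := by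
  refine ⟨{x | 1 / ((n : ℝ) + 1) ≤ Metric.infDist x Ωᶜ} ∩ Metric.closedBall 0 (n + 1),
    (isCompact_closedBall 0 _).inter_left
      (isClosed_le continuous_const (Metric.continuous_infDist_pt _)),
    inter_subset_inter (fun x hx => ?_) Metric.ball_subset_closedBall, fun x hx => ?_⟩
  · have h1 : 1 / ((n : ℝ) + 1) < Metric.infDist x Ωᶜ := hx
    exact h1.le
  by_contra h
  have h1 : (1 : ℝ) / (n + 1) ≤ Metric.infDist x Ωᶜ := hx.1
  rw [Metric.infDist_zero_of_mem h] at h1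
  exact absurd h1 (not_le.2 Nat.one_div_pos_of_nat)

/-- Nonemptiness of the complement matters because `Metric.infDist` to the empty set is zero by
convention. -/
theorem subset_iUnion_innerExhaustion {Ω : Set E3} (hΩ : IsOpen Ω) (hne : Ωᶜ.Nonempty) :
    Ω ⊆ ⋃ n, innerExhaustion Ω n := by
  intro x hx
  have hpos : 0 < Metric.infDist x Ωᶜ :=
    (hΩ.isClosed_compl.notMem_iff_infDist_pos hne).1 fun h => h hx
  obtain ⟨n, hn⟩ := exists_nat_one_div_lt hpos
  obtain ⟨m, hm⟩ := exists_nat_gt ‖x‖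
  refine mem_iUnion.2 ⟨max n m, ?_, ?_⟩
  · exact (Nat.one_div_le_one_div (le_max_left n m)).trans_lt hn
  · rw [mem_ball_zero_iff]
    have : (m : ℝ) ≤ (max n m : ℕ) := by exact_mod_cast le_max_right n m
    linarith

theorem enteringSet_mono {D D' : Set E3} (h : D \ {0} ⊆ D' \ {0}) (u : E3 → E3) (α r : ℝ) :
    enteringSet D u α r ⊆ enteringSet D' u α r := by
  rintro η ⟨hη, s, hs, γ, hγ, hγs⟩
  exact ⟨hη, s, hs, γ, ⟨hγ.start, fun t ht => h (hγ.mem_domain t ht), hγ.hasDeriv⟩, hγs⟩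

/-- A streamline over `Icc 0 s` has compact image, hence lies in a single member of the increasing
exhaustion. -/
theorem enteringSet_eq_iUnion {D : Set E3} (hD : IsOpen D) (u : E3 → E3) (α r : ℝ) :
    enteringSet D u α r = ⋃ n, enteringSet (innerExhaustion (D \ {0}) n) u α r := by
  have hne : (D \ {0})ᶜ.Nonempty := ⟨0, fun h => h.2 rfl⟩
  have hopen : IsOpen (D \ {0}) := hD.sdiff isClosed_singleton
  refine Subset.antisymm ?_ (iUnion_subset fun n => enteringSet_mono (fun x hx => ?_) u α r)
  · rintro η ⟨hη, s, hs, γ, hγ, hγs⟩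
    have hcont : ContinuousOn γ (Icc 0 s) := fun t ht => (hγ.hasDeriv t ht).continuousWithinAt
    obtain ⟨n, hn⟩ := (isCompact_Icc.image_of_continuousOn hcont).elim_directed_cover
      (innerExhaustion (D \ {0})) (isOpen_innerExhaustion _)
      ((image_subset_iff.2 hγ.mem_domain).trans (subset_iUnion_innerExhaustion hopen hne))
      (monotone_innerExhaustion _).directed_le
    refine mem_iUnion.2 ⟨n, hη, s, hs, γ, ⟨hγ.start, fun t ht => ⟨hn ⟨t, ht, rfl⟩, ?_⟩,
      hγ.hasDeriv⟩, hγs⟩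
    exact (hγ.mem_domain t ht).2
  · obtain ⟨K, -, h1, h2⟩ := exists_isCompact_innerExhaustion_subset (D \ {0}) n
    exact h2 (h1 hx.1)

/-- The flux of a divergence-free field through the entering set is controlled by the integral of
its norm over a shell. -/
theorem ofReal_mul_enorm_sphereFlux_le {D : Set E3} (hD : IsOpen D) {u : E3 → E3}
    (hu : ContDiffOn ℝ 1 u (D \ {0})) (hdiv : ∀ x ∈ D \ {0}, divergence u x = 0)
    {α r : ℝ} (hα : 0 < α) (hrα : 2 * r ≤ α) :
    ENNReal.ofReal r * ‖sphereFlux u α (enteringSet D u α r)‖ₑ ≤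
      ∫⁻ x in D ∩ shell r, ‖u x‖ₑ := by
  have hΩ : IsOpen (D \ {0}) := hD.sdiff isClosed_singleton
  -- No integrability is required: a divergent Bochner integral is zero by default and the bound is
  -- trivial.
  refine (mul_le_mul_right (enorm_integral_le_lintegral_enorm _) _).trans ?_
  rw [enteringSet_eq_iUnion hD, setLIntegral_iUnion_of_directed _
    (Monotone.directed_le fun n m hnm => enteringSet_mono
      (sdiff_subset_sdiff_left (monotone_innerExhaustion _ hnm)) u α r), ENNReal.mul_iSup]
  refine iSup_le fun n => ?_
  set O := innerExhaustion (D \ {0}) n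
  have hO : IsOpen O := isOpen_innerExhaustion _ _
  obtain ⟨K, hK, hOK, hKΩ⟩ := exists_isCompact_innerExhaustion_subset (D \ {0}) n
  obtain ⟨v, hv, hc, huv⟩ := hu.exists_hasCompactSupport_eqOn hΩ hK hKΩ
  have huvO : EqOn u v O := huv.mono hOK
  have hO0 : (0 : E3) ∉ O := fun h => (hKΩ (hOK h)).2 rfl
  obtain ⟨L, hL⟩ := hv.lipschitzWith_of_hasCompactSupport hc one_ne_zero
  obtain ⟨M, hM⟩ := hc.exists_bound_of_continuous hv.continuous
  obtain ⟨Φ, hΦ⟩ := exists_isFlow hL (M := M.toNNReal)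
    fun x => (hM x).trans (Real.le_coe_toNNReal M)
  have hdivv : ∀ x ∈ O, divergence v x = 0 := by
    intro x hx
    have : v =ᶠ[𝓝 x] u := by
      filter_upwards [hO.mem_nhds hx] with y hy
      exact (huvO hy).symm
    rw [divergence, this.fderiv_eq]
    exact hdiv x (hKΩ (hOK hx))
  have hA := hΦ.measurableSet_enteringSet (α := α) (r := r) hv hc hO hO0 huvO
  have hAO : enteringSet O u α r ⊆ O := by
    rintro η ⟨-, s, hs, γ, hγ, -⟩
    have := (hγ.mem_domain 0 ⟨le_rfl, hs.le⟩).1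
    rwa [hγ.start] at this
  calc _ = ENNReal.ofReal r * ∫⁻ η in enteringSet O u α r,
          ‖inner ℝ (v η) (unitNormal η)‖ₑ ∂sphereMeasure α := by
        congr 1
        exact setLIntegral_congr_fun hA fun η hη => by simp only [huvO (hAO hη)]
    _ ≤ ∫⁻ x in O, (shell r).indicator (fun x => ‖v x‖ₑ) x :=
        hΦ.mul_setLIntegral_enteringSet_le hv hc hO hO0 huvO hdivv hα hrα
    _ = ∫⁻ x in O ∩ shell r, ‖u x‖ₑ := by
        rw [setLIntegral_indicator (isOpen_shell r).measurableSet, inter_comm]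
        exact setLIntegral_congr_fun (hO.inter (isOpen_shell r)).measurableSet
          fun x hx => by simp only [huvO hx.1]
    _ ≤ _ := lintegral_mono_set
        (inter_subset_inter_left _ fun x hx => (hKΩ (hOK hx)).1)

/-! ### Cauchy–Schwarz, small shells and the contradiction. -/

theorem sq_lintegral_le {X : Type*} [MeasurableSpace X] (μ : Measure X) {f : X → ENNReal}
    (hf : AEMeasurable f μ) : (∫⁻ x, f x ∂μ) ^ 2 ≤ (∫⁻ x, f x ^ 2 ∂μ) * μ univ := by
  have h := ENNReal.lintegral_mul_le_Lp_mul_Lq μ Real.HolderConjugate.two_two hf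
    (aemeasurable_const (b := (1 : ENNReal)))
  have hsq : ∀ y : ENNReal, (y ^ (1 / 2 : ℝ)) ^ 2 = y := fun y => by
    rw [← ENNReal.rpow_two, ← ENNReal.rpow_mul]
    norm_num
  have h2 := pow_le_pow_left₀ zero_le h 2
  rw [mul_pow, hsq, hsq] at h2
  simpa using h2

theorem volume_shell_le {r : ℝ} (hr : 0 ≤ r) :
    volume (shell r) ≤ ENNReal.ofReal (r ^ 3) * (8 * volume (Metric.ball (0 : E3) 1)) := by
  have hsub : shell r ⊆ Metric.ball 0 (2 * r) := fun x hx => mem_ball_zero_iff.2 hx.2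
  refine (measure_mono hsub).trans (le_of_eq ?_)
  rw [Measure.addHaar_ball _ _ (by positivity), finrank_euclideanSpace_fin, mul_pow,
    mul_comm (2 ^ 3 : ℝ), ENNReal.ofReal_mul (by positivity), mul_assoc]
  norm_num

/-- Absolute continuity of the integral, since the shells have volume of order `r ^ 3`. -/
theorem tendsto_lintegral_shell {D : Set E3} {f : E3 → ENNReal}
    (hf : ∫⁻ x in D, f x ≠ ⊤) :
    Tendsto (fun r => ∫⁻ x in D ∩ shell r, f x) (𝓝[>] 0) (𝓝 0) := by
  have hvol : Tendsto (fun r : ℝ => ENNReal.ofReal (r ^ 3) *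
      (8 * volume (Metric.ball (0 : E3) 1))) (𝓝[>] 0) (𝓝 0) := by
    have h1 : Tendsto (fun r : ℝ => ENNReal.ofReal (r ^ 3)) (𝓝[>] 0) (𝓝 0) := by
      have : Continuous fun r : ℝ => ENNReal.ofReal (r ^ 3) :=
        ENNReal.continuous_ofReal.comp (continuous_pow 3)
      simpa using (this.tendsto 0).mono_left nhdsWithin_le_nhds
    have hne : 8 * volume (Metric.ball (0 : E3) 1) ≠ ⊤ :=
      ENNReal.mul_ne_top (by simp) measure_ball_lt_top.ne
    simpa only [zero_mul] using ENNReal.Tendsto.mul_const h1 (Or.inr hne)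
  have h := tendsto_setLIntegral_zero (μ := volume.restrict D) (s := shell) (l := 𝓝[>] (0 : ℝ)) hf
    (tendsto_of_tendsto_of_tendsto_of_le_of_le' tendsto_const_nhds hvol
      (Eventually.of_forall fun _ => zero_le) ?_)
  · refine h.congr fun r => ?_
    rw [Measure.restrict_restrict (isOpen_shell r).measurableSet, inter_comm]
  · filter_upwards [self_mem_nhdsWithin] with r hr
    exact (Measure.restrict_apply_le _ _).trans (volume_shell_le (le_of_lt hr))

theorem theorem1 (D : Set E3) (hD : IsOpen D) (h0 : (0 : E3) ∈ D)
    (u : E3 → E3) (hu : ContDiffOn ℝ 1 u (D \ {0}))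
    (hdiv : ∀ x ∈ D \ {0}, divergence u x = 0)
    (α : ℝ) (hα : 0 < α) (C : ℝ) (hC : 0 < C)
    (hflux : ∀ᶠ r in 𝓝[>] (0 : ℝ),
      C * r ^ (1 / 2 : ℝ) ≤ |sphereFlux u α (enteringSet D u α r)|) :
    ¬ MemLp u 2 (volume.restrict D) := by
  intro hmem
  have hfin : ∫⁻ x in D, ‖u x‖ₑ ^ 2 ≠ ⊤ := by
    simpa using (lintegral_rpow_enorm_lt_top_of_eLpNorm_lt_top two_ne_zero ENNReal.ofNat_ne_top
      hmem.eLpNorm_lt_top).ne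
  set c : ENNReal := 8 * volume (Metric.ball (0 : E3) 1) with hc
  have hctop : c ≠ ⊤ := ENNReal.mul_ne_top (by simp) measure_ball_lt_top.ne
  have hbound : ∀ᶠ r in 𝓝[>] (0 : ℝ),
      ENNReal.ofReal (C ^ 2) ≤ (∫⁻ x in D ∩ shell r, ‖u x‖ₑ ^ 2) * c := by
    filter_upwards [hflux, self_mem_nhdsWithin, Ioo_mem_nhdsGT (half_pos hα)] with r hr hr0 hrα
    have hr0 : 0 < r := hr0
    have hrα2 : 2 * r ≤ α := by linarith [hrα.2]
    have haem : AEMeasurable (fun x => ‖u x‖ₑ) (volume.restrict (D ∩ shell r)) :=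
      (hmem.aestronglyMeasurable.mono_measure
        (Measure.restrict_mono inter_subset_left le_rfl)).enorm
    -- This is where the exponent `1 / 2` is critical: the square is of order `r ^ 3`, exactly the
    -- order of the shell volume.
    have hsqrt : (r * (C * r ^ (1 / 2 : ℝ))) ^ 2 = r ^ 3 * C ^ 2 := by
      rw [← Real.sqrt_eq_rpow, mul_pow, mul_pow, Real.sq_sqrt hr0.le]
      ring
    have hmain : ENNReal.ofReal (r ^ 3) * ENNReal.ofReal (C ^ 2) ≤
        ENNReal.ofReal (r ^ 3) * ((∫⁻ x in D ∩ shell r, ‖u x‖ₑ ^ 2) * c) :=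
      calc ENNReal.ofReal (r ^ 3) * ENNReal.ofReal (C ^ 2)
          = (ENNReal.ofReal r * ENNReal.ofReal (C * r ^ (1 / 2 : ℝ))) ^ 2 := by
            rw [← ENNReal.ofReal_mul (by positivity), ← ENNReal.ofReal_mul hr0.le,
              ← ENNReal.ofReal_pow (by positivity), hsqrt]
        _ ≤ (ENNReal.ofReal r * ‖sphereFlux u α (enteringSet D u α r)‖ₑ) ^ 2 := by
            gcongr
            rw [Real.enorm_eq_ofReal_abs]
            exact ENNReal.ofReal_le_ofReal hr
        _ ≤ (∫⁻ x in D ∩ shell r, ‖u x‖ₑ) ^ 2 := by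
            gcongr
            exact ofReal_mul_enorm_sphereFlux_le hD hu hdiv hα hrα2
        _ ≤ (∫⁻ x in D ∩ shell r, ‖u x‖ₑ ^ 2) * volume (D ∩ shell r) := by
            simpa using sq_lintegral_le _ haem
        _ ≤ (∫⁻ x in D ∩ shell r, ‖u x‖ₑ ^ 2) * (ENNReal.ofReal (r ^ 3) * c) := by
            gcongr
            exact (measure_mono inter_subset_right).trans (volume_shell_le hr0.le)
        _ = _ := by ring
    exact (ENNReal.mul_le_mul_iff_right (by simpa using pow_pos hr0 3) ENNReal.ofReal_ne_top).1
      hmain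
  have hlim : Tendsto (fun r => (∫⁻ x in D ∩ shell r, ‖u x‖ₑ ^ 2) * c) (𝓝[>] 0) (𝓝 0) := by
    simpa using ENNReal.Tendsto.mul_const (tendsto_lintegral_shell hfin) (Or.inr hctop)
  have hle := ge_of_tendsto hlim hbound
  have hpos : 0 < ENNReal.ofReal (C ^ 2) := ENNReal.ofReal_pos.2 (by positivity)
  exact absurd hle (not_le.2 hpos)
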